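/- Let $\mathbb{k}$ be a field, let $G$ be a finite simple graph with vertex set $V$ and edges $e_1,\dots,e_r$, let $R=\mathbb{k}[x_v : v\in V]$ and $\mathfrak m=(x_v : v\in V)$, and let $I=I(G)=(f_1,\dots,f_r)\subseteq R$ be its edge ideal, where $f_j=x_ax_b$ if $e_j=\{a,b\}$. Let $J$ be the Rees ideal of $I$, that is, the kernel of the $R$-algebra map $R[T_1,\dots,T_r]\to R[It]$, $T_j\mapsto f_jt$. Let $\phi$ be the presentation matrix of $I$ from its Taylor resolution: it has one column for each pair $j<k$, with entry $-\operatorname{lcm}(f_j,f_k)/f_j$ in row $j$, entry $\operatorname{lcm}(f_j,f_k)/f_k$ in row $k$, and zeros elsewhere. Let $B(\phi)$ be a Jacobian dual of $\phi$, that is, a matrix whose entries are linear forms in $T_1,\dots,T_r$ over $R$ and which satisfies $[T_1\ \cdots\ T_r]\cdot\phi=[x_v]_{v\in V}\cdot B(\phi)$. Let $\overline{B(\phi)}$, a matrix over $\mathbb{k}[T_1,\dots,T_r]$, be its reduction modulo $\mathfrak m$, and let $k=\operatorname{rank}\overline{B(\phi)}$ (the rank over the field of fractions). Then all nonlinear generators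 of $J$ are factors of generators of the ideal $I_k(\overline{B(\phi)})$ of $k\times k$ minors. Precisely: 1. If $S$ is any minimal (irredundant) system of generators of $J$ that consists of binomials (sums of two nonzero scalar multiples of distinct monomials in the $x_v$ and $T_j$), then every $f\in S$ that is not linear (homogeneous of degree $1$) in $T_1,\dots,T_r$ divides, in $R[T_1,\dots,T_r]$, some nonzero $k\times k$ minor of $\overline{B(\phi)}$. 2. Let $W=(v_0,v_1,\dots,v_{2t}=v_0)$ be a primitive even closed walk in $G$, meaning that it contains no even closed subwalk (section $v_i,v_{i+1},\dots,v_j$ with $v_i=v_j$ and $j-i$ even) other than those of length $0$ and $W$ itself. Let $T_{(i)}$ be the variable of the edge $\{v_i,v_{i+1}\}$. If the binomial $f_W=\prod_{i\text{ even}}T_{(i)}-\prod_{i\text{ odd}}T_{(i)}$ (over $0\le i<2t$) is nonzero, then $f_W$ divides some nonzero $k\times k$ minor of $\overline{B(\phi)}$ in $\mathbb{k}[T_1,\dots,T_r]$. -/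

import Mathlib

noncomputable section

namespace EdgeRees

/-- The exponent vector of the monomial `x_a x_b` attached to an unordered pair `{a, b}`. -/
def edgeExp {V : Type*} : Sym2 V → (V →₀ ℕ) :=
  Sym2.lift ⟨fun a b => Finsupp.single a 1 + Finsupp.single b 1, fun _ _ => add_comm _ _⟩

/-- The quadratic monomial `x_a x_b` attached to an unordered pair `{a, b}`. -/
def edgeMonomial (𝕜 : Type*) [Field 𝕜] {V : Type*} (s : Sym2 V) : MvPolynomial V 𝕜 :=
  MvPolynomial.monomial (edgeExp s) 1

theorem edgeMonomial_mk (𝕜 : Type*) [Field 𝕜] {V : Type*} (a b : V) :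
    edgeMonomial 𝕜 s(a, b) = MvPolynomial.X a * MvPolynomial.X b := by
  simp [edgeMonomial, edgeExp, MvPolynomial.X, MvPolynomial.monomial_mul]

/-- The edge ideal `I(G) = ⟨x_a x_b : ab an edge of G⟩` in `R = 𝕜[x_v : v ∈ V]`. -/
def edgeIdeal (𝕜 : Type*) [Field 𝕜] {V : Type*} (G : SimpleGraph V) :
    Ideal (MvPolynomial V 𝕜) :=
  Ideal.span {f | ∃ a b, G.Adj a b ∧ f = MvPolynomial.X a * MvPolynomial.X b}

theorem edgeMonomial_mem (𝕜 : Type*) [Field 𝕜] {V : Type*} (G : SimpleGraph V)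
    (s : G.edgeSet) : edgeMonomial 𝕜 (s : Sym2 V) ∈ edgeIdeal 𝕜 G := by
  obtain ⟨s, hs⟩ := s
  induction s using Sym2.ind with
  | _ a b => exact Ideal.subset_span ⟨a, b, hs, edgeMonomial_mk 𝕜 a b⟩

/-- The natural presentation `θ : R[T_1, …, T_r] → R[It]`, `T_j ↦ f_j t`, of the Rees algebra of
`I = I(G)`, where `f_j` is the monomial of the `j`-th edge in the labelling `e` of the edges. -/
def reesMap (𝕜 : Type*) [Field 𝕜] {V : Type*} (G : SimpleGraph V) {r : ℕ}
    (e : Fin r ≃ G.edgeSet) :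
    MvPolynomial (Fin r) (MvPolynomial V 𝕜) →ₐ[MvPolynomial V 𝕜]
      reesAlgebra (edgeIdeal 𝕜 G) :=
  MvPolynomial.aeval fun j =>
    ⟨Polynomial.monomial 1 (edgeMonomial 𝕜 (e j : Sym2 V)),
      reesAlgebra.monomial_mem.mpr (by simpa using edgeMonomial_mem 𝕜 G (e j))⟩

/-- The Rees ideal (defining ideal of the Rees algebra) `J = ker θ`. -/
def reesIdeal (𝕜 : Type*) [Field 𝕜] {V : Type*} (G : SimpleGraph V) {r : ℕ}
    (e : Fin r ≃ G.edgeSet) : Ideal (MvPolynomial (Fin r) (MvPolynomial V 𝕜)) :=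
  RingHom.ker (reesMap 𝕜 G e)

/-- The two-element subsets `{j < k}` of the index set `{1, …, r}`. -/
abbrev Pairs (r : ℕ) : Type := {p : Fin r × Fin r // p.1 < p.2}

/-- The presentation matrix of `I(G)` from the Taylor resolution. The column of `{j < k}` has the
entry `-lcm(f_j, f_k)/f_j` in row `j`, the entry `lcm(f_j, f_k)/f_k` in row `k`, and zeros
elsewhere. On exponent vectors the least common multiple is the supremum `⊔`, and the quotient of
monomials is the (here exact) difference. -/
def taylorMatrix (𝕜 : Type*) [Field 𝕜] {V : Type*} (G : SimpleGraph V) {r : ℕ}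
    (e : Fin r ≃ G.edgeSet) : Matrix (Fin r) (Pairs r) (MvPolynomial V 𝕜) :=
  Matrix.of fun i p =>
    let u : Fin r → (V →₀ ℕ) := fun j => edgeExp (e j : Sym2 V)
    let q : MvPolynomial V 𝕜 := MvPolynomial.monomial ((u p.1.1 ⊔ u p.1.2) - u i) 1
    if i = p.1.1 then -q else if i = p.1.2 then q else 0

/-- `B` is a Jacobian dual of `φ`: its entries are linear forms in `T_1, …, T_r` over
`R = 𝕜[x_v : v ∈ V]`, and `[T_1 … T_r] · φ = [x_v]_{v ∈ V} · B`. -/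
def IsJacobianDual {𝕜 : Type*} [Field 𝕜] {V : Type*} [Fintype V] {r : ℕ} {C : Type*}
    (φ : Matrix (Fin r) C (MvPolynomial V 𝕜))
    (B : Matrix V C (MvPolynomial (Fin r) (MvPolynomial V 𝕜))) : Prop :=
  (∀ v c, (B v c).IsHomogeneous 1) ∧
    Matrix.vecMul (fun j : Fin r => MvPolynomial.X j) (φ.map MvPolynomial.C) =
      Matrix.vecMul (fun v : V => MvPolynomial.C (MvPolynomial.X v)) B

/-- Reduction of a matrix over `R[T_1, …, T_r]` modulo `𝔪 = (x_v : v ∈ V)`, with `R/𝔪 = 𝕜`. -/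
def reduce {𝕜 : Type*} [Field 𝕜] {V : Type*} {r : ℕ} {C : Type*}
    (B : Matrix V C (MvPolynomial (Fin r) (MvPolynomial V 𝕜))) :
    Matrix V C (MvPolynomial (Fin r) 𝕜) :=
  B.map (MvPolynomial.map MvPolynomial.constantCoeff)

/-- The rank of a matrix over a domain, i.e. its rank over the field of fractions. -/
def genericRank {A : Type*} [CommRing A] [IsDomain A] {m C : Type*} [Fintype C]
    (M : Matrix m C A) : ℕ :=
  (M.map (algebraMap A (FractionRing A))).rank

/-- The set of `t × t` minors of a matrix. -/
def minors {A : Type*} [CommRing A] {m C : Type*} (M : Matrix m C A) (t : ℕ) : Set A :=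
  {g | ∃ (ρ : Fin t ↪ m) (γ : Fin t ↪ C), g = (M.submatrix ρ γ).det}

/-- `f ∈ R[T_1, …, T_r]` is a binomial: a sum of two nonzero scalar multiples of distinct
monomials in the variables `x_v` and `T_j`. -/
def IsBinomial {𝕜 : Type*} [Field 𝕜] {V : Type*} {r : ℕ}
    (f : MvPolynomial (Fin r) (MvPolynomial V 𝕜)) : Prop :=
  ∃ (u u' : Fin r →₀ ℕ) (a a' : V →₀ ℕ) (α α' : 𝕜), (u, a) ≠ (u', a') ∧ α ≠ 0 ∧ α' ≠ 0 ∧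
    f = MvPolynomial.monomial u (MvPolynomial.monomial a α) +
      MvPolynomial.monomial u' (MvPolynomial.monomial a' α')

/-- `S` is a minimal system of binomial generators of the ideal `J`: it consists of binomials, it
generates `J`, and no element of it can be left out. -/
def IsMinimalBinomialGenerators {𝕜 : Type*} [Field 𝕜] {V : Type*} {r : ℕ}
    (J : Ideal (MvPolynomial (Fin r) (MvPolynomial V 𝕜)))
    (S : Set (MvPolynomial (Fin r) (MvPolynomial V 𝕜))) : Prop :=
  (∀ f ∈ S, IsBinomial f) ∧ Ideal.span S = J ∧ ∀ f ∈ S, Ideal.span (S \ {f}) ≠ J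

/-- A closed walk of even length is primitive if it contains no even closed subwalk, other than
the trivial ones of length zero and the whole walk. -/
def IsPrimitiveEven {V : Type*} {G : SimpleGraph V} {v : V} (p : G.Walk v v) : Prop :=
  Even p.length ∧ ∀ (w : V) (q : G.Walk w w), q.IsSubwalk p → Even q.length →
    q.length = 0 ∨ q.length = p.length

/-- The index of the `i`-th edge (counted from `0`) of a walk. -/
def walkEdge {V : Type*} {G : SimpleGraph V} {r : ℕ} (e : Fin r ≃ G.edgeSet) {v w : V}
    (p : G.Walk v w) (i : Fin p.length) : Fin r :=
  e.symm ⟨s(p.getVert i, p.getVert (i + 1)), p.adj_getVert_succ i.2⟩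

/-- The binomial `∏ T_{e_{2i}} - ∏ T_{e_{2i+1}}` of an even closed walk `e_0, e_1, e_2, …`: the
difference of the products over every other edge, with multiplicity. -/
def walkBinomial (𝕜 : Type*) [Field 𝕜] {V : Type*} {G : SimpleGraph V} {r : ℕ}
    (e : Fin r ≃ G.edgeSet) {v : V} (p : G.Walk v v) : MvPolynomial (Fin r) 𝕜 :=
  (∏ i : Fin p.length, if Even (i : ℕ) then MvPolynomial.X (walkEdge e p i) else 1) -
    ∏ i : Fin p.length, if Even (i : ℕ) then 1 else MvPolynomial.X (walkEdge e p i)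

end EdgeRees

end

/-! ### Completing a minor to maximal size; cyclic determinants -/

namespace EdgeRees

open Matrix

/-! Both claims reduce to even closed walks that repeat no vertex at equal parity, except at the
ends (`IsEvenCycle`).

Modulo `𝔪`, the column of two edges `{c, a}`, `{a, b}` with variables `T_j`, `T_k` keeps only `±T_k`
in row `c` and `∓T_j` in row `b`, whichever Jacobian dual is taken. For such a walk, pair its edges
at positions `2i`, `2i+1` to get columns and use the vertices at even positions as rows. The
resulting square submatrix is cyclic bidiagonal up to signs of columns, so its determinant is the
walk binomial up to sign. These columns vanish in all other rows, so completing the submatrix to a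
nonzero minor of maximal size gives a block triangular matrix, and the walk binomial divides that
minor (`IsEvenCycle.exists_minor_dvd`).

A primitive even closed walk is such a walk. It remains to see that a nonlinear binomial `f` in an
irredundant system is, up to a scalar, the binomial of such a walk. By homogeneity, the other
generators generate all binomials of `J` of smaller total degree. If an exchange inside one monomial
of `f` produces a factor in common with the other, `f` is a combination of smaller binomials, a
contradiction. Suitable exchanges first exclude the `x_v`, and then all proper parts of the two edge
families that have equal vertex degrees (`exists_isEvenCycle_of_not_mem`). Since two nonempty
families with equal vertex degrees always contain an alternating even cycle (`exists_isEvenCycle`),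
that cycle is everything. -/

/-- A linearly independent family of vectors of a finite family extends, by further members of the
family, to one that spans the same space. -/
theorem exists_sumElim_linearIndependent {K W C : Type*} [Field K] [AddCommGroup W] [Module K W]
    [Finite C] (c : C → W) {t : ℕ} (γ : Fin t → C) (h : LinearIndependent K (c ∘ γ)) :
    ∃ (s : ℕ) (γ' : Fin s → C),
      t + s = Module.finrank K (Submodule.span K (Set.range c)) ∧
      LinearIndependent K (c ∘ Sum.elim γ γ') := by
  classical
  have hinj : Function.Injective γ := h.injective.of_comp
  obtain ⟨b, -, hsb, hspan, hb⟩ := exists_linearIndepOn_extension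
    (K := K) (v := c) (s := Set.range γ) (t := Set.univ)
    ((linearIndepOn_range_iff hinj c).2 h) (Set.subset_univ _)
  have hfin : Finite ↥(b \ Set.range γ) := inferInstance
  obtain ⟨s, ⟨eqv⟩⟩ := Finite.exists_equiv_fin ↥(b \ Set.range γ)
  let γ' : Fin s → C := fun i => (eqv.symm i : C)
  have hmem : ∀ x : Fin t ⊕ Fin s, Sum.elim γ γ' x ∈ b := by
    rintro (i | i)
    · exact hsb ⟨i, rfl⟩
    · exact (eqv.symm i).2.1
  let g : Fin t ⊕ Fin s → b := fun x => ⟨Sum.elim γ γ' x, hmem x⟩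
  have hg : Function.Bijective g := by
    constructor
    · rintro (i | i) (j | j) hij
      · exact congrArg Sum.inl (hinj (congrArg Subtype.val hij))
      · exact absurd ⟨i, congrArg Subtype.val hij⟩ (eqv.symm j).2.2
      · exact absurd ⟨j, (congrArg Subtype.val hij).symm⟩ (eqv.symm i).2.2
      · have h' := congrArg Subtype.val hij
        exact congrArg Sum.inr (eqv.symm.injective (Subtype.ext h'))
    · rintro ⟨x, hx⟩
      by_cases hxγ : x ∈ Set.range γ
      · obtain ⟨i, rfl⟩ := hxγ
        exact ⟨Sum.inl i, rfl⟩
      · exact ⟨Sum.inr (eqv ⟨x, hx, hxγ⟩), by simp [g, γ']⟩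
  have hli : LinearIndependent K (c ∘ Sum.elim γ γ') :=
    LinearIndependent.comp (ι' := Fin t ⊕ Fin s) hb g hg.injective
  refine ⟨s, γ', ?_, hli⟩
  have hrange : Submodule.span K (Set.range (c ∘ Sum.elim γ γ')) =
      Submodule.span K (Set.range c) := by
    have h1 : Set.range (Sum.elim γ γ') = b := by
      ext x
      constructor
      · rintro ⟨y, rfl⟩
        exact hmem y
      · intro hx
        obtain ⟨y, hy⟩ := hg.surjective ⟨x, hx⟩
        exact ⟨y, congrArg Subtype.val hy⟩
    rw [Set.range_comp, h1]
    refine le_antisymm (Submodule.span_mono (Set.image_subset_range _ _)) ?_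
    rw [Submodule.span_le, ← Set.image_univ]
    exact hspan
  rw [← hrange, finrank_span_eq_card hli]
  simp

/-- Over a domain, a nonzero minor whose columns vanish outside of its rows divides a nonzero minor
of maximal size. -/
theorem exists_minor_dvd {A m C : Type*} [CommRing A] [IsDomain A] [Fintype m] [Fintype C]
    (M : Matrix m C A) {t : ℕ} (ρ : Fin t → m) (γ : Fin t → C)
    (hdet : (M.submatrix ρ γ).det ≠ 0) (hzero : ∀ i v, v ∉ Set.range ρ → M v (γ i) = 0) :
    ∃ g ∈ minors M (genericRank M), g ≠ 0 ∧ (M.submatrix ρ γ).det ∣ g := by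
  classical
  let K := FractionRing A
  let φ : A →+* K := algebraMap A K
  have hφ : Function.Injective φ := IsFractionRing.injective A K
  let N : Matrix m C K := M.map φ
  have hNdet : (N.submatrix ρ γ).det ≠ 0 := by
    have : N.submatrix ρ γ = (M.submatrix ρ γ).map φ := rfl
    rw [this, ← RingHom.mapMatrix_apply, ← RingHom.map_det]
    exact (map_ne_zero_iff φ hφ).2 hdet
  -- Independence already holds after restriction to the coordinates `ρ`.
  have hcols : LinearIndependent K (N.col ∘ γ) := by
    have h := Matrix.linearIndependent_cols_of_det_ne_zero hNdet
    exact LinearIndependent.of_comp (LinearMap.funLeft K K ρ) h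
  obtain ⟨s, γ', hs, hγ'⟩ := exists_sumElim_linearIndependent N.col γ hcols
  rw [← Matrix.rank_eq_finrank_span_cols] at hs
  let N' : Matrix m (Fin t ⊕ Fin s) K := N.submatrix id (Sum.elim γ γ')
  have hrows : LinearIndependent K (N'.row ∘ ρ) := by
    have h := Matrix.linearIndependent_rows_of_det_ne_zero hNdet
    exact LinearIndependent.of_comp (LinearMap.funLeft K K Sum.inl) h
  obtain ⟨s', ρ', hs', hρ'⟩ := exists_sumElim_linearIndependent N'.row ρ hrows
  -- The chosen columns are independent, so row rank equals column rank forces as many new rows as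
  -- new columns.
  have hrank' : N'.rank = t + s := by
    have h : LinearIndependent K N'ᵀ.row := hγ'
    rw [← Matrix.rank_transpose, h.rank_matrix]
    simp
  rw [← Matrix.rank_eq_finrank_span_row, hrank'] at hs'
  obtain rfl : s' = s := by omega
  have hinjγ : Function.Injective (Sum.elim γ γ') := hγ'.injective.of_comp
  have hinjρ : Function.Injective (Sum.elim ρ ρ') := hρ'.injective.of_comp
  have hk : genericRank M = t + s' := hs.symm
  let M' : Matrix (Fin t ⊕ Fin s') (Fin t ⊕ Fin s') A :=
    M.submatrix (Sum.elim ρ ρ') (Sum.elim γ γ')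
  have hM' : M'.det ≠ 0 := by
    have h : LinearIndependent K (M'.map φ).row := hρ'
    have h1 := Matrix.linearIndependent_rows_iff_isUnit.1 h
    rw [Matrix.isUnit_iff_isUnit_det, ← RingHom.mapMatrix_apply, ← RingHom.map_det] at h1
    exact fun h0 => h1.ne_zero (by rw [h0, map_zero])
  rw [hk]
  let eqv : Fin (t + s') ≃ Fin t ⊕ Fin s' := finSumFinEquiv.symm
  refine ⟨M'.det, ⟨⟨Sum.elim ρ ρ' ∘ eqv, hinjρ.comp eqv.injective⟩,
    ⟨Sum.elim γ γ' ∘ eqv, hinjγ.comp eqv.injective⟩, ?_⟩, hM', ?_⟩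
  · exact (Matrix.det_submatrix_equiv_self eqv M').symm
  -- The added rows lie outside `ρ`, where the columns `γ` vanish.
  · have hblock : M' = Matrix.fromBlocks (M.submatrix ρ γ) (M.submatrix ρ γ') 0
        (M.submatrix ρ' γ') := by
      ext (i | i) (j | j)
      · rfl
      · rfl
      · refine hzero j _ ?_
        rintro ⟨i', hi'⟩
        exact absurd (@hinjρ (Sum.inl i') (Sum.inr i) hi') (by simp)
      · rfl
    rw [hblock, Matrix.det_fromBlocks_zero₂₁]
    exact dvd_mul_right _ _

/-- The determinant of a cyclic bidiagonal matrix. -/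
theorem det_cyclic_bidiagonal {A : Type*} [CommRing A] {t : ℕ} (a b : Fin (t + 2) → A) :
    (Matrix.of fun i j : Fin (t + 2) =>
      (if i = j then a j else 0) - (if i = j + 1 then b j else 0)).det =
      ∏ i, a i - ∏ i, b i := by
  set M : Matrix (Fin (t + 2)) (Fin (t + 2)) A := Matrix.of fun i j =>
      (if i = j then a j else 0) - (if i = j + 1 then b j else 0) with hM
  have hlast : Fin.last (t + 1) = (Fin.last t).succ := rfl
  have hadd : ∀ j : Fin (t + 1), j.castSucc + 1 = j.succ := fun j => Fin.coeSucc_eq_succ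
  -- Row `0` has only its two corner entries. Expanding along it leaves a lower triangular minor
  -- with diagonal `a` and an upper triangular one with diagonal `-b`.
  have h00 : M 0 0 = a 0 := by simp [hM]
  have h0l : M 0 (Fin.last (t + 1)) = - b (Fin.last (t + 1)) := by
    have : (0 : Fin (t + 2)) ≠ Fin.last (t + 1) := by simp [Fin.ext_iff]
    simp [hM, this]
  have h0 : ∀ j : Fin (t + 2), j ≠ 0 → j ≠ Fin.last (t + 1) → M 0 j = 0 := by
    intro j hj0 hjl
    obtain ⟨j, rfl⟩ := Fin.exists_castSucc_eq.2 hjl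
    simp [hM, hj0.symm, (Fin.succ_ne_zero j).symm]
  have hd0 : (M.submatrix Fin.succ (Fin.succAbove 0)).det = ∏ i : Fin (t + 1), a i.succ := by
    rw [Matrix.det_of_isLowerTriangular]
    · refine Finset.prod_congr rfl fun i _ => ?_
      have : i.succ ≠ i.succ + 1 := by simp
      simp [hM]
    · intro i j hij
      have hij : i < j := hij
      have h1 : i.succ ≠ j.succ := by simpa using hij.ne
      have h2 : i.succ ≠ j.succ + 1 := by
        intro h
        rcases Fin.eq_castSucc_or_eq_last j.succ with ⟨l, hl⟩ | hl
        · rw [hl, hadd] at h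
          have := congrArg Fin.val hl
          have h' := congrArg Fin.val h
          simp at this h'
          have : (i : ℕ) < j := hij
          omega
        · rw [hl] at h
          simp at h
      simp [hM, h1, h2]
  have hdl : (M.submatrix Fin.succ (Fin.succAbove (Fin.last (t + 1)))).det =
      (-1) ^ (t + 1) * ∏ i : Fin (t + 1), b i.castSucc := by
    rw [Matrix.det_of_isUpperTriangular]
    · have : ∀ i : Fin (t + 1), M.submatrix Fin.succ (Fin.succAbove (Fin.last (t + 1))) i i =
          -1 * b i.castSucc := by
        intro i
        have h1 : i.succ ≠ i.castSucc := by simp [Fin.ext_iff]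
        simp [hM, h1]
      rw [Finset.prod_congr rfl fun i _ => this i, Finset.prod_mul_distrib]
      simp
    · intro i j hij
      have hij : (j : ℕ) < i := hij
      have h1 : i.succ ≠ j.castSucc := by
        simp only [ne_eq, Fin.ext_iff, Fin.val_succ, Fin.val_castSucc]; omega
      have h2 : i.succ ≠ j.succ := by
        simp only [ne_eq, Fin.ext_iff, Fin.val_succ]; omega
      have h3 : i ≠ j := fun h => by simp [h] at hij
      simp [hM, h1, h3]
  rw [Matrix.det_succ_row_zero, Fin.sum_univ_succ, Fin.sum_univ_castSucc, Finset.sum_eq_zero]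
  · rw [← hlast, h00, h0l, hd0, hdl, Fin.prod_univ_succ a, Fin.prod_univ_castSucc b]
    -- The cofactor sign cancels the signs of the diagonal entries `-b`.
    have : ((-1 : A) ^ (t + 1)) * (-1) ^ (t + 1) = 1 := by
      rw [← mul_pow]; simp
    simp only [Fin.val_zero, pow_zero, one_mul, zero_add, Fin.val_last]
    linear_combination (-(b (Fin.last (t + 1))) * ∏ i : Fin (t + 1), b i.castSucc) * this
  · intro i _
    rw [h0 _ (Fin.succ_ne_zero _) (by simp [Fin.ext_iff]; omega)]
    simp

end EdgeRees

/-! ### The reduced Jacobian dual -/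

namespace EdgeRees

open MvPolynomial

theorem edgeExp_mk {V : Type*} (a b : V) :
    edgeExp s(a, b) = Finsupp.single a 1 + Finsupp.single b 1 := rfl

/-- Applied to `[x_v] · B`, this reads off an entry of `B` modulo `𝔪`. -/
theorem coeff_single_sum_X_mul {R σ : Type*} [CommSemiring R] [Fintype σ]
    (g : σ → MvPolynomial σ R) (w : σ) :
    coeff (Finsupp.single w 1) (∑ v, X v * g v) = constantCoeff (g w) := by
  classical
  rw [coeff_sum, Finset.sum_eq_single w]
  · have := coeff_X_mul (0 : σ →₀ ℕ) w (g w)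
    simpa [constantCoeff_eq] using this
  · intro v _ hv
    rw [coeff_X_mul', if_neg]
    simpa [Finsupp.single_apply, eq_comm] using hv
  · simp

theorem IsHomogeneous.eq_sum_X {R σ : Type*} [CommSemiring R] [Fintype σ]
    {p : MvPolynomial σ R} (hp : p.IsHomogeneous 1) :
    p = ∑ l, C (coeff (Finsupp.single l 1) p) * X l := by
  classical
  ext d
  rw [coeff_sum]
  simp only [coeff_C_mul, coeff_X]
  by_cases hd : d.degree = 1
  · obtain ⟨l, rfl⟩ := (Finsupp.sum_eq_one_iff d).1 hd
    rw [Finset.sum_eq_single l]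
    · simp
    · intro l' _ hl'
      rw [if_neg, mul_zero]
      simpa [Finsupp.single_left_inj] using hl'
    · simp
  · rw [hp.coeff_eq_zero hd, Finset.sum_eq_zero]
    intro l _
    rw [if_neg, mul_zero]
    rintro rfl
    simp at hd

/-- For two edges `{c, a}` and `{a, b}` meeting in `a`, the complementary factor of the first
monomial in the least common multiple is `x_b`. -/
theorem edgeExp_sup_sub {a b c : V} (hab : a ≠ b) (hcb : c ≠ b) :
    (edgeExp s(c, a) ⊔ edgeExp s(a, b)) - edgeExp s(c, a) = Finsupp.single b 1 := by
  classical
  ext x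
  simp only [edgeExp_mk, Finsupp.tsub_apply, Finsupp.sup_apply, Finsupp.add_apply,
    Finsupp.single_apply]
  by_cases hb : b = x
  · subst hb
    simp [hab, hcb]
  · by_cases ha : a = x <;> by_cases hc : c = x <;> simp [hb, ha, hc]

section

variable {𝕜 : Type*} [Field 𝕜] {V : Type*} [Fintype V] {r : ℕ}

/-- The reduction of a Jacobian dual is determined by the linear part of the matrix. -/
theorem reduce_apply_of_isJacobianDual {Γ : Type*}
    {φ : Matrix (Fin r) Γ (MvPolynomial V 𝕜)}
    {B : Matrix V Γ (MvPolynomial (Fin r) (MvPolynomial V 𝕜))} (hB : IsJacobianDual φ B)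
    (w : V) (c : Γ) :
    reduce B w c = ∑ l, C (coeff (Finsupp.single w 1) (φ l c)) * X l := by
  classical
  have hhom : (reduce B w c).IsHomogeneous 1 := (hB.1 w c).map _
  rw [IsHomogeneous.eq_sum_X hhom]
  refine Finset.sum_congr rfl fun l _ => ?_
  congr 2
  -- Compare the coefficients of `T_l`, and then of `x_w`, in the defining equation.
  have h1 := congrArg (coeff (Finsupp.single l 1)) (congrFun hB.2 c)
  simp only [Matrix.vecMul, dotProduct, coeff_sum, coeff_C_mul, Matrix.map_apply,
    mul_comm (X _) (C (φ _ _)), coeff_X] at h1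
  rw [Finset.sum_eq_single l] at h1
  · have h2 := congrArg (coeff (Finsupp.single w 1)) h1
    rw [coeff_single_sum_X_mul] at h2
    simp only [if_true, mul_one] at h2
    rw [h2]
    simp [reduce, coeff_map]
  · intro l' _ hl'
    rw [if_neg, mul_zero]
    simpa [Finsupp.single_left_inj] using hl'
  · simp

/-- The pair of two distinct indices. -/
def mkPair {r : ℕ} (j k : Fin r) (h : j ≠ k) : Pairs r :=
  if hlt : j < k then ⟨(j, k), hlt⟩ else ⟨(k, j), lt_of_le_of_ne (not_lt.1 hlt) h.symm⟩

/-- The column of the reduced Jacobian dual that belongs to two edges `{c, a}` and `{a, b}`. -/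
theorem reduce_mkPair [DecidableEq V] {G : SimpleGraph V} {e : Fin r ≃ G.edgeSet}
    {B : Matrix V (Pairs r) (MvPolynomial (Fin r) (MvPolynomial V 𝕜))}
    (hB : IsJacobianDual (taylorMatrix 𝕜 G e) B) {j k : Fin r} {a b c : V}
    (hj : (e j : Sym2 V) = s(c, a)) (hk : (e k : Sym2 V) = s(a, b)) (hcb : c ≠ b) (hjk : j ≠ k)
    (w : V) :
    reduce B w (mkPair j k hjk) = (if j < k then 1 else -1) *
      ((if w = c then X k else 0) - (if w = b then X j else 0)) := by
  have hab : a ≠ b := by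
    have := (e k).2
    rw [hk] at this
    exact G.ne_of_adj this
  have hca : c ≠ a := by
    have := (e j).2
    rw [hj] at this
    exact G.ne_of_adj this
  have hsj : (edgeExp (e j : Sym2 V) ⊔ edgeExp (e k : Sym2 V)) - edgeExp (e j : Sym2 V) =
      Finsupp.single b 1 := by
    rw [hj, hk]; exact edgeExp_sup_sub hab hcb
  have hsk : (edgeExp (e j : Sym2 V) ⊔ edgeExp (e k : Sym2 V)) - edgeExp (e k : Sym2 V) =
      Finsupp.single c 1 := by
    rw [hj, hk, sup_comm, Sym2.eq_swap (a := c), Sym2.eq_swap (a := a) (b := b)]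
    exact edgeExp_sup_sub hca.symm hcb.symm
  have hcoeff : ∀ x : V, coeff (Finsupp.single w 1) (monomial (Finsupp.single x 1) (1 : 𝕜)) =
      if w = x then 1 else 0 := by
    intro x
    simp [coeff_monomial, Finsupp.single_left_inj, eq_comm]
  rw [reduce_apply_of_isJacobianDual hB,
    ← Finset.sum_subset (Finset.subset_univ {j, k}), Finset.sum_pair hjk]
  · by_cases hlt : j < k
    · simp only [taylorMatrix, mkPair, hlt, dif_pos, Matrix.of_apply, if_true, hjk.symm, if_false,
        hsj, hsk, coeff_neg, hcoeff]
      split_ifs <;> simp [neg_add_eq_sub]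
    · simp only [taylorMatrix, mkPair, hlt, dif_neg, Matrix.of_apply, if_true, hjk, if_false,
        sup_comm (edgeExp (e k : Sym2 V)), hsj, hsk, coeff_neg, hcoeff, not_false_eq_true]
      split_ifs <;> simp [← sub_eq_add_neg]
  · intro l _ hl
    simp only [Finset.mem_insert, Finset.mem_singleton, not_or] at hl
    have : taylorMatrix 𝕜 G e l (mkPair j k hjk) = 0 := by
      by_cases hlt : j < k <;> simp [taylorMatrix, mkPair, hlt, hl.1, hl.2]
    simp [this]

end

end EdgeRees

/-! ### Even cycles and their minors -/

namespace EdgeRees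

open MvPolynomial

/-- The exponent of the product of the variables with even position in a sequence. -/
noncomputable def evenExp {r : ℕ} (j : ℕ → Fin r) (n : ℕ) : Fin r →₀ ℕ :=
  ∑ i ∈ Finset.range n, if Even i then Finsupp.single (j i) 1 else 0

/-- The exponent of the product of the variables with odd position in a sequence. -/
noncomputable def oddExp {r : ℕ} (j : ℕ → Fin r) (n : ℕ) : Fin r →₀ ℕ :=
  ∑ i ∈ Finset.range n, if Even i then 0 else Finsupp.single (j i) 1

/-- `v_0, v_1, …, v_n = v_0` is a closed walk of positive even length with edges
`e_{j_0}, …, e_{j_{n-1}}` that visits no vertex twice at positions of the same parity, except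
for its end points. -/
structure IsEvenCycle {V : Type*} {G : SimpleGraph V} {r : ℕ} (e : Fin r ≃ G.edgeSet)
    (v : ℕ → V) (j : ℕ → Fin r) (n : ℕ) : Prop where
  pos : 0 < n
  even : Even n
  edge : ∀ i < n, (e (j i) : Sym2 V) = s(v i, v (i + 1))
  closed : v n = v 0
  inj : ∀ i i', i < i' → i' ≤ n → Even (i' - i) → v i = v i' → i = 0 ∧ i' = n

theorem evenExp_two_mul {r : ℕ} (j : ℕ → Fin r) (t : ℕ) :
    evenExp j (2 * t) = ∑ i ∈ Finset.range t, Finsupp.single (j (2 * i)) 1 := by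
  induction t with
  | zero => simp [evenExp]
  | succ t ih =>
    rw [Finset.sum_range_succ, ← ih, evenExp, show 2 * (t + 1) = 2 * t + 1 + 1 by ring,
      Finset.sum_range_succ, Finset.sum_range_succ]
    simp [evenExp]

theorem oddExp_two_mul {r : ℕ} (j : ℕ → Fin r) (t : ℕ) :
    oddExp j (2 * t) = ∑ i ∈ Finset.range t, Finsupp.single (j (2 * i + 1)) 1 := by
  induction t with
  | zero => simp [oddExp]
  | succ t ih =>
    rw [Finset.sum_range_succ, ← ih, oddExp, show 2 * (t + 1) = 2 * t + 1 + 1 by ring,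
      Finset.sum_range_succ, Finset.sum_range_succ]
    simp [oddExp]

theorem monomial_sum_single {R σ : Type*} [CommSemiring R] (s : Finset ℕ) (f : ℕ → σ) :
    monomial (∑ i ∈ s, Finsupp.single (f i) 1) (1 : R) = ∏ i ∈ s, X (f i) := by
  rw [monomial_sum_one]
  rfl

section

variable {𝕜 : Type*} [Field 𝕜] {V : Type*} {G : SimpleGraph V} {r : ℕ} {e : Fin r ≃ G.edgeSet}

/-- A cycle of length two runs along one edge and back, so its two products agree. -/
theorem IsEvenCycle.four_le {v : ℕ → V} {j : ℕ → Fin r} {n : ℕ} (h : IsEvenCycle e v j n)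
    (hne : evenExp j n ≠ oddExp j n) : 4 ≤ n := by
  obtain ⟨t, ht⟩ := h.even
  have hpos := h.pos
  by_contra hlt
  obtain rfl : n = 2 := by omega
  have h0 := h.edge 0 (by omega)
  have h1 := h.edge 1 (by omega)
  rw [h.closed, Sym2.eq_swap, ← h0] at h1
  have h2 : j 1 = j 0 := e.injective (Subtype.ext h1)
  apply hne
  simp [evenExp, oddExp, Finset.sum_range_succ, h2]

variable [Fintype V]

/-- The columns of consecutive edge pairs, on the rows of the vertices at even positions, form a
cyclic bidiagonal matrix and vanish elsewhere. -/
theorem IsEvenCycle.exists_minor_dvd {v : ℕ → V} {j : ℕ → Fin r} {n : ℕ}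
    (h : IsEvenCycle e v j n) (hne : evenExp j n ≠ oddExp j n)
    {B : Matrix V (Pairs r) (MvPolynomial (Fin r) (MvPolynomial V 𝕜))}
    (hB : IsJacobianDual (taylorMatrix 𝕜 G e) B) :
    ∃ g ∈ minors (reduce B) (genericRank (reduce B)), g ≠ 0 ∧
      (monomial (evenExp j n) (1 : 𝕜) - monomial (oddExp j n) 1) ∣ g := by
  classical
  obtain ⟨t, ht⟩ : ∃ t, n = 2 * (t + 2) := by
    obtain ⟨t, ht⟩ := h.even
    have := h.four_le hne
    exact ⟨t - 2, by omega⟩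
  have hv : ∀ i : ℕ, i < t + 2 → v (2 * i) ≠ v (2 * i + 2) := by
    intro i hi heq
    have := h.inj (2 * i) (2 * i + 2) (by omega) (by omega) (by simp) heq
    omega
  have hj : ∀ i : ℕ, i < t + 2 → j (2 * i) ≠ j (2 * i + 1) := by
    intro i hi heq
    have h0 := h.edge (2 * i) (by omega)
    have h1 := h.edge (2 * i + 1) (by omega)
    rw [← heq, h0, Sym2.eq_swap] at h1
    exact hv i hi (Sym2.congr_right.1 h1)
  have hinj : ∀ i i' : ℕ, i < t + 2 → i' < t + 2 → v (2 * i) = v (2 * i') → i = i' := by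
    intro i i' hi hi' heq
    rcases lt_trichotomy i i' with hlt | rfl | hlt
    · have := h.inj (2 * i) (2 * i') (by omega) (by omega)
        ⟨i' - i, by omega⟩ heq
      omega
    · rfl
    · have := h.inj (2 * i') (2 * i) (by omega) (by omega)
        ⟨i - i', by omega⟩ heq.symm
      omega
  -- The wraparound of `Fin (t + 2)` matches `v n = v 0`.
  have hcyc : ∀ i i' : Fin (t + 2), v (2 * i) = v (2 * i' + 2) ↔ i = i' + 1 := by
    intro i i'
    rw [Fin.ext_iff, Fin.val_add_one]
    split_ifs with hlast
    · have h1 : 2 * (i' : ℕ) + 2 = n := by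
        rw [hlast, Fin.val_last]; omega
      rw [h1, h.closed]
      exact ⟨fun heq => hinj i 0 i.2 (by omega) heq, fun heq => by rw [heq]⟩
    · have hlt : (i' : ℕ) + 1 < t + 2 := by
        have := i'.2
        have h2 : (i' : ℕ) ≠ t + 1 := fun h3 => hlast (Fin.ext h3)
        omega
      exact ⟨fun heq => hinj i (i' + 1) i.2 hlt heq, fun heq => by rw [heq]; ring_nf⟩
  let ρ : Fin (t + 2) → V := fun i => v (2 * i)
  let γ : Fin (t + 2) → Pairs r := fun i => mkPair (j (2 * i)) (j (2 * i + 1)) (hj i i.2)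
  -- The sign records whether `mkPair` had to swap the two edges.
  let σ : Fin (t + 2) → MvPolynomial (Fin r) 𝕜 := fun i =>
    if j (2 * i) < j (2 * i + 1) then 1 else -1
  have hcol : ∀ w (i : Fin (t + 2)), reduce B w (γ i) = σ i *
      ((if w = v (2 * i) then X (j (2 * i + 1)) else 0) -
        (if w = v (2 * i + 2) then X (j (2 * i)) else 0)) := fun w i =>
    reduce_mkPair hB (h.edge (2 * i) (by omega)) (h.edge (2 * i + 1) (by omega)) (hv i i.2)
      (hj i i.2) w
  have hsub : (reduce B).submatrix ρ γ = Matrix.of fun i i' => σ i' *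
      (Matrix.of fun i i' : Fin (t + 2) =>
        (if i = i' then (X (j (2 * i' + 1)) : MvPolynomial (Fin r) 𝕜) else 0) -
        (if i = i' + 1 then X (j (2 * i')) else 0)) i i' := by
    ext1 i i'
    have h1 : v (2 * i) = v (2 * i') ↔ i = i' :=
      ⟨fun heq => Fin.ext (hinj i i' i.2 i'.2 heq), fun heq => by rw [heq]⟩
    rw [Matrix.submatrix_apply, hcol]
    simp only [ρ, h1, hcyc, Matrix.of_apply]
  have hdet : ((reduce B).submatrix ρ γ).det =
      (∏ i, σ i) * (monomial (oddExp j n) 1 - monomial (evenExp j n) 1) := by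
    rw [hsub, Matrix.det_mul_row, det_cyclic_bidiagonal, ht, evenExp_two_mul, oddExp_two_mul,
      monomial_sum_single, monomial_sum_single,
      Finset.prod_range fun i => (X (j (2 * i + 1)) : MvPolynomial (Fin r) 𝕜),
      Finset.prod_range fun i => (X (j (2 * i)) : MvPolynomial (Fin r) 𝕜)]
  have hσ : ∏ i, σ i ≠ 0 := by
    refine Finset.prod_ne_zero_iff.2 fun i _ => ?_
    simp only [σ]
    split_ifs <;> simp
  obtain ⟨g, hg, hg0, hdvd⟩ := EdgeRees.exists_minor_dvd (reduce B) ρ γ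
    (by
      rw [hdet]
      refine mul_ne_zero hσ (sub_ne_zero.2 fun heq => hne ?_)
      exact (monomial_left_injective (one_ne_zero (α := 𝕜)) heq).symm)
    (by
      intro i w hw
      have h1 : w ≠ v (2 * i) := fun heq => hw ⟨i, heq.symm⟩
      -- The second nonzero entry of column `i` lies in row `ρ (i + 1)`.
      have h2 : w ≠ v (2 * i + 2) := fun heq => hw ⟨i + 1, by
        rw [heq]; exact (hcyc (i + 1) i).2 rfl⟩
      rw [hcol]
      simp [h1, h2])
  refine ⟨g, hg, hg0, dvd_trans ?_ hdvd⟩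
  rw [hdet, ← neg_sub (monomial (evenExp j n) (1 : 𝕜))]
  exact dvd_mul_of_dvd_right (dvd_neg.2 dvd_rfl) _

end

end EdgeRees

/-! ### Alternating walks in edge families with equal vertex degrees -/

namespace EdgeRees

open MvPolynomial

/-- The sequence `x, s_0, s_1, …`. -/
def prepend {α : Type*} (x : α) (s : ℕ → α) : ℕ → α
  | 0 => x
  | i + 1 => s i

@[simp]
theorem prepend_zero {α : Type*} (x : α) (s : ℕ → α) : prepend x s 0 = x := rfl

@[simp]
theorem prepend_succ {α : Type*} (x : α) (s : ℕ → α) (i : ℕ) : prepend x s (i + 1) = s i := rfl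

/-- Prepending swaps the parities of all positions. Hence the two edge families change roles
whenever a walk is prolonged. -/
theorem evenExp_prepend {r : ℕ} (l : Fin r) (j : ℕ → Fin r) (n : ℕ) :
    evenExp (prepend l j) (n + 1) = oddExp j n + Finsupp.single l 1 := by
  rw [evenExp, Finset.sum_range_succ', oddExp]
  congr 1
  refine Finset.sum_congr rfl fun i _ => ?_
  by_cases hi : Even i <;> simp [Nat.even_add_one, hi]

theorem oddExp_prepend {r : ℕ} (l : Fin r) (j : ℕ → Fin r) (n : ℕ) :
    oddExp (prepend l j) (n + 1) = evenExp j n := by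
  rw [oddExp, Finset.sum_range_succ', evenExp]
  simp only [Even.zero, if_true, add_zero]
  refine Finset.sum_congr rfl fun i _ => ?_
  by_cases hi : Even i <;> simp [Nat.even_add_one, hi]

theorem evenExp_mono {r : ℕ} (j : ℕ → Fin r) {m n : ℕ} (h : m ≤ n) : evenExp j m ≤ evenExp j n :=
  Finset.sum_le_sum_of_subset (Finset.range_mono h)

theorem oddExp_mono {r : ℕ} (j : ℕ → Fin r) {m n : ℕ} (h : m ≤ n) : oddExp j m ≤ oddExp j n :=
  Finset.sum_le_sum_of_subset (Finset.range_mono h)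

theorem degree_evenExp_add_degree_oddExp {r : ℕ} (j : ℕ → Fin r) (n : ℕ) :
    (evenExp j n).degree + (oddExp j n).degree = n := by
  induction n with
  | zero => simp [evenExp, oddExp]
  | succ n ih =>
    rw [evenExp, oddExp, Finset.sum_range_succ, Finset.sum_range_succ, ← evenExp, ← oddExp,
      map_add, map_add]
    by_cases hn : Even n <;> simp [hn] <;> omega

section

variable {V : Type*} {G : SimpleGraph V} {r : ℕ} (e : Fin r ≃ G.edgeSet)

/-- The exponent of the image of a monomial in the `T_j` under `T_j ↦ f_j`. -/
noncomputable def edgeDegree : (Fin r →₀ ℕ) →+ (V →₀ ℕ) :=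
  (Finsupp.linearCombination ℕ fun j => edgeExp (e j : Sym2 V)).toAddMonoidHom

@[simp]
theorem edgeDegree_single (j : Fin r) (n : ℕ) :
    edgeDegree e (Finsupp.single j n) = n • edgeExp (e j : Sym2 V) := by
  simp [edgeDegree]

theorem degree_edgeDegree (u : Fin r →₀ ℕ) : (edgeDegree e u).degree = 2 * u.degree := by
  induction u using Finsupp.induction_linear with
  | zero => simp
  | add f g hf hg => rw [map_add, map_add, map_add, hf, hg]; ring
  | single j n =>
    have : (edgeExp (e j : Sym2 V)).degree = 2 := by
      induction (e j : Sym2 V) using Sym2.ind with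
      | _ a b => simp [edgeExp_mk]
    simp [this, mul_comm]

theorem exists_edge_of_edgeDegree_ne_zero {u : Fin r →₀ ℕ} {w : V} (h : edgeDegree e u w ≠ 0) :
    ∃ l y, u l ≠ 0 ∧ (e l : Sym2 V) = s(w, y) := by
  classical
  have h1 : edgeDegree e u w = ∑ l ∈ u.support, u l * edgeExp (e l : Sym2 V) w := by
    simp [edgeDegree, Finsupp.linearCombination_apply, Finsupp.sum, Finsupp.finsetSum_apply]
  rw [h1] at h
  obtain ⟨l, hl, hne⟩ := Finset.exists_ne_zero_of_sum_ne_zero h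
  refine ⟨l, ?_⟩
  have hmem : w ∈ (e l : Sym2 V) := by
    have h2 := right_ne_zero_of_mul hne
    revert h2
    induction (e l : Sym2 V) using Sym2.ind with
    | _ a b =>
      intro h2
      rw [edgeExp_mk, Finsupp.add_apply, Finsupp.single_apply, Finsupp.single_apply] at h2
      rw [Sym2.mem_iff]
      by_contra hcon
      push Not at hcon
      simp [hcon.1.symm, hcon.2.symm] at h2
  obtain ⟨y, hy⟩ := hmem
  exact ⟨y, left_ne_zero_of_mul hne, hy⟩

/-- The two exponents of an alternating walk differ by its end points. -/
theorem edgeDegree_evenExp {v : ℕ → V} {j : ℕ → Fin r} {n : ℕ}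
    (hedge : ∀ i < n, (e (j i) : Sym2 V) = s(v i, v (i + 1))) :
    edgeDegree e (evenExp j n) + (if Even n then Finsupp.single (v n) 1 else 0) =
      edgeDegree e (oddExp j n) + Finsupp.single (v 0) 1 +
        (if Even n then 0 else Finsupp.single (v n) 1) := by
  induction n with
  | zero => simp [evenExp, oddExp]
  | succ n ih =>
    specialize ih fun i hi => hedge i (by omega)
    have hn := hedge n (by omega)
    rw [evenExp, oddExp, Finset.sum_range_succ, Finset.sum_range_succ, ← evenExp, ← oddExp,
      map_add, map_add]
    by_cases he : Even n
    · simp only [he, if_true, add_zero, Nat.even_add_one, not_true, if_false, edgeDegree_single,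
        one_smul, map_zero, hn, edgeExp_mk] at ih ⊢
      rw [← add_assoc, ih]
    · simp only [he, if_true, add_zero, Nat.even_add_one, not_false_eq_true, if_false,
        edgeDegree_single, one_smul, map_zero, hn, edgeExp_mk] at ih ⊢
      rw [ih]
      abel

theorem IsEvenCycle.edgeDegree_eq {e : Fin r ≃ G.edgeSet} {v : ℕ → V} {j : ℕ → Fin r} {n : ℕ}
    (h : IsEvenCycle e v j n) :
    edgeDegree e (evenExp j n) = edgeDegree e (oddExp j n) := by
  have := edgeDegree_evenExp e h.edge
  simpa [h.even, h.closed] using this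

/-- An alternating walk without repetitions at equal parity inside of two families of edges with
equal vertex degrees can be prolonged to one that closes up. -/
theorem exists_isEvenCycle_of_walk (m : ℕ) : ∀ (a b : Fin r →₀ ℕ) (v : ℕ → V) (j : ℕ → Fin r)
    (n : ℕ), edgeDegree e a = edgeDegree e b → 0 < n →
    (∀ i < n, (e (j i) : Sym2 V) = s(v i, v (i + 1))) →
    (∀ i i', i < i' → i' ≤ n → Even (i' - i) → v i ≠ v i') →
    evenExp j n ≤ a → oddExp j n ≤ b → a.degree + b.degree < n + m →
    ∃ (v : ℕ → V) (j : ℕ → Fin r) (n : ℕ), IsEvenCycle e v j n ∧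
      (evenExp j n ≤ a ∧ oddExp j n ≤ b ∨ evenExp j n ≤ b ∧ oddExp j n ≤ a) := by
  classical
  induction m with
  | zero =>
    -- A walk inside the two families has at most `a.degree + b.degree` edges.
    intro a b v j n _ _ _ _ ha hb hm
    exfalso
    obtain ⟨a', rfl⟩ := le_iff_exists_add.1 ha
    obtain ⟨b', rfl⟩ := le_iff_exists_add.1 hb
    have := degree_evenExp_add_degree_oddExp j n
    rw [map_add, map_add] at hm
    omega
  | succ m ih =>
    intro a b v j n hab hn hedge hne ha hb hm
    -- At `v 0` the walk has used more degree from `a` than from `b`. As the total degrees agree, an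
    -- unused edge of `b` remains there.
    obtain ⟨l, y, hl, hy⟩ : ∃ l y, oddExp j n + Finsupp.single l 1 ≤ b ∧
        (e l : Sym2 V) = s(v 0, y) := by
      obtain ⟨a', rfl⟩ := le_iff_exists_add.1 ha
      obtain ⟨b', rfl⟩ := le_iff_exists_add.1 hb
      have hb' : edgeDegree e b' (v 0) ≠ 0 := by
        have h1 := DFunLike.congr_fun hab (v 0)
        have h2 := DFunLike.congr_fun (edgeDegree_evenExp e hedge) (v 0)
        rw [map_add, map_add, Finsupp.add_apply, Finsupp.add_apply] at h1
        simp only [Finsupp.add_apply, Finsupp.single_eq_same] at h2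
        by_cases he : Even n
        · have hv : v n ≠ v 0 := (hne 0 n hn le_rfl (by simpa using he)).symm
          simp [he, hv.symm] at h2
          omega
        · simp only [he, if_false, Finsupp.coe_zero, Pi.zero_apply] at h2
          omega
      obtain ⟨l, y, hl, hy⟩ := exists_edge_of_edgeDegree_ne_zero e hb'
      refine ⟨l, y, ?_, hy⟩
      gcongr
      exact Finsupp.single_le_iff.2 (Nat.one_le_iff_ne_zero.2 hl)
    have hedge' : ∀ i < n + 1, (e (prepend l j i) : Sym2 V) =
        s(prepend y v i, prepend y v (i + 1)) := by
      rintro (_ | i) hi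
      · simpa [Sym2.eq_swap] using hy
      · exact hedge i (by omega)
    have heven : evenExp (prepend l j) (n + 1) ≤ b := by rwa [evenExp_prepend]
    have hodd : oddExp (prepend l j) (n + 1) ≤ a := by rwa [oddExp_prepend]
    -- Only the new vertex `y` can cause a repetition. If it does, the initial section up to that
    -- repetition is the cycle.
    by_cases hrep : ∃ i ≤ n + 1, 0 < i ∧ Even i ∧ prepend y v 0 = prepend y v i
    · obtain ⟨i, hin, hi0, hie, hi⟩ := hrep
      refine ⟨prepend y v, prepend l j, i, ⟨hi0, hie, fun k hk => hedge' k (by omega), hi.symm, ?_⟩,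
        Or.inr ⟨(evenExp_mono _ hin).trans heven, (oddExp_mono _ hin).trans hodd⟩⟩
      have hpos : ∀ k k', 0 < k → k < k' → k' ≤ n + 1 → Even (k' - k) →
          prepend y v k ≠ prepend y v k' := by
        rintro (_ | k) (_ | k') h0 hlt hle hev
        · omega
        · omega
        · omega
        · exact hne k k' (by omega) (by omega) (by simpa using hev)
      intro k k' hlt hle hev heq
      rcases Nat.eq_zero_or_pos k with rfl | hk
      · refine ⟨rfl, ?_⟩
        by_contra hk'
        -- A second return to `y` would repeat a vertex at equal parity in the old walk.
        refine hpos k' i hlt (by omega) hin ?_ (heq.symm.trans hi)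
        exact (Nat.even_sub hle).2 ⟨fun _ => by simpa using hev, fun _ => hie⟩
      · exact absurd heq (hpos k k' hk hlt (by omega) hev)
    · push Not at hrep
      obtain ⟨v', j', n', hc, hle⟩ := ih b a (prepend y v) (prepend l j) (n + 1) hab.symm
        (by omega) hedge' (by
          rintro (_ | k) (_ | k') hlt hle hev
          · omega
          · exact hrep _ hle (by omega) (by simpa using hev)
          · omega
          · exact hne k k' (by omega) (by omega) (by simpa using hev)) heven hodd (by omega)
      exact ⟨v', j', n', hc, hle.symm⟩

/-- Two nonempty families of edges with equal vertex degrees contain an alternating even cycle. -/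
theorem exists_isEvenCycle {a b : Fin r →₀ ℕ} (hab : edgeDegree e a = edgeDegree e b)
    (ha : a ≠ 0) : ∃ (v : ℕ → V) (j : ℕ → Fin r) (n : ℕ), IsEvenCycle e v j n ∧
      (evenExp j n ≤ a ∧ oddExp j n ≤ b ∨ evenExp j n ≤ b ∧ oddExp j n ≤ a) := by
  obtain ⟨l, hl⟩ := Finsupp.ne_iff.1 ha
  obtain ⟨x, y, hxy⟩ : ∃ x y, (e l : Sym2 V) = s(x, y) := by
    induction (e l : Sym2 V) using Sym2.ind with
    | _ x y => exact ⟨x, y, rfl⟩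
  refine exists_isEvenCycle_of_walk e (a.degree + b.degree) a b (prepend x fun _ => y)
    (fun _ => l) 1 hab one_pos ?_ ?_ ?_ ?_ (by omega)
  · intro i hi
    obtain rfl : i = 0 := by omega
    exact hxy
  · intro i i' hlt hle hev
    obtain ⟨rfl, rfl⟩ : i = 0 ∧ i' = 1 := by omega
    simp at hev
  · simpa [evenExp, Nat.one_le_iff_ne_zero] using hl
  · simp [oddExp]

end

section

variable {𝕜 : Type*} [Field 𝕜] {V : Type*} {G : SimpleGraph V} {r : ℕ} {e : Fin r ≃ G.edgeSet}

/-- The vertices and edges of a primitive even closed walk form an even cycle. -/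
theorem IsPrimitiveEven.isEvenCycle {v : V} {p : G.Walk v v} (hp : IsPrimitiveEven p)
    {j : ℕ → Fin r} (hj : ∀ i : Fin p.length, j i = walkEdge e p i) (hpos : 0 < p.length) :
    IsEvenCycle e p.getVert j p.length where
  pos := hpos
  even := hp.1
  edge i hi := by
    have := hj ⟨i, hi⟩
    simp only at this
    rw [this, walkEdge, Equiv.apply_symm_apply]
  closed := by simp
  inj i i' hlt hle hev heq := by
    -- The section from `i` to `i'` is an even closed subwalk of positive length, so primitivity
    -- makes it as long as the whole walk.
    let q : G.Walk (p.getVert i) (p.getVert i) :=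
      ((p.drop i).take (i' - i)).copy rfl (by
        rw [SimpleGraph.Walk.drop_getVert, Nat.add_sub_cancel' hlt.le, heq])
    have hq : q.length = i' - i := by
      simp only [q, SimpleGraph.Walk.length_copy, SimpleGraph.Walk.take_length,
        SimpleGraph.Walk.drop_length]
      omega
    have hsub : q.IsSubwalk p :=
      (((p.drop i).isSubwalk_take (i' - i)).trans (p.isSubwalk_drop i)).copy _ _ rfl rfl
    have := hp.2 _ q hsub (hq ▸ hev)
    omega

theorem exists_walkEdge_extension {v : V} (p : G.Walk v v) (hpos : 0 < p.length) :
    ∃ j : ℕ → Fin r, ∀ i : Fin p.length, j i = walkEdge e p i :=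
  ⟨fun i => if h : i < p.length then walkEdge e p ⟨i, h⟩ else walkEdge e p ⟨0, hpos⟩,
    fun i => by simp⟩

theorem walkBinomial_eq {v : V} {p : G.Walk v v} {j : ℕ → Fin r}
    (hj : ∀ i : Fin p.length, j i = walkEdge e p i) :
    walkBinomial 𝕜 e p = monomial (evenExp j p.length) 1 - monomial (oddExp j p.length) 1 := by
  rw [walkBinomial, evenExp, oddExp, monomial_sum_one, monomial_sum_one,
    Finset.prod_range fun i => monomial (if Even i then Finsupp.single (j i) 1 else 0) (1 : 𝕜),
    Finset.prod_range fun i => monomial (if Even i then 0 else Finsupp.single (j i) 1) (1 : 𝕜)]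
  congr 1 <;> refine Finset.prod_congr rfl fun i _ => ?_ <;> rw [← hj i] <;> split_ifs <;> rfl

end

end EdgeRees

/-! ### Binomials of the Rees ideal and total degree -/

namespace EdgeRees

open MvPolynomial

section

variable {𝕜 : Type*} [Field 𝕜] {V : Type*} {r : ℕ}

/-- The monomial `T^u x^a`. -/
noncomputable def mono (𝕜 : Type*) [Field 𝕜] {V : Type*} {r : ℕ}
    (p : (Fin r →₀ ℕ) × (V →₀ ℕ)) : MvPolynomial (Fin r) (MvPolynomial V 𝕜) :=
  monomial p.1 (monomial p.2 1)

theorem mono_add (p q : (Fin r →₀ ℕ) × (V →₀ ℕ)) :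
    mono 𝕜 (p + q) = mono 𝕜 p * mono 𝕜 q := by
  simp [mono, monomial_mul]

/-- The total degree of the monomial `T^u x^a`. -/
noncomputable def totalDeg (p : (Fin r →₀ ℕ) × (V →₀ ℕ)) : ℕ := p.1.degree + p.2.degree

theorem totalDeg_add (p q : (Fin r →₀ ℕ) × (V →₀ ℕ)) :
    totalDeg (p + q) = totalDeg p + totalDeg q := by
  simp [totalDeg]; ring

variable {G : SimpleGraph V} (e : Fin r ≃ G.edgeSet)

/-- The monomials `T^u x^a` and `T^u' x^a'` have the same image in the Rees algebra. -/
def SameImage (p q : (Fin r →₀ ℕ) × (V →₀ ℕ)) : Prop :=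
  p.1.degree = q.1.degree ∧ p.2 + edgeDegree e p.1 = q.2 + edgeDegree e q.1

variable {e}

theorem SameImage.symm {p q : (Fin r →₀ ℕ) × (V →₀ ℕ)} (h : SameImage e p q) :
    SameImage e q p := ⟨h.1.symm, h.2.symm⟩

theorem SameImage.trans {p q s : (Fin r →₀ ℕ) × (V →₀ ℕ)} (h : SameImage e p q)
    (h' : SameImage e q s) : SameImage e p s := ⟨h.1.trans h'.1, h.2.trans h'.2⟩

theorem sameImage_add_left_iff {c p q : (Fin r →₀ ℕ) × (V →₀ ℕ)} :
    SameImage e (c + p) (c + q) ↔ SameImage e p q := by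
  have h : ∀ p : (Fin r →₀ ℕ) × (V →₀ ℕ), (c + p).2 + edgeDegree e (c + p).1 =
      (c.2 + edgeDegree e c.1) + (p.2 + edgeDegree e p.1) := by
    intro p
    simp only [Prod.fst_add, Prod.snd_add, map_add]
    abel
  rw [SameImage, h, h, add_right_inj, SameImage]
  simp

/-- Each `T_j` maps to a monomial of degree two in the `x_v`, so equal degrees in the `T_j` leave
equal degrees in the `x_v`. -/
theorem SameImage.degree_snd {p q : (Fin r →₀ ℕ) × (V →₀ ℕ)} (h : SameImage e p q) :
    p.2.degree = q.2.degree := by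
  have := congrArg Finsupp.degree h.2
  rw [map_add, map_add, degree_edgeDegree, degree_edgeDegree, h.1] at this
  omega

theorem SameImage.totalDeg_eq {p q : (Fin r →₀ ℕ) × (V →₀ ℕ)} (h : SameImage e p q) :
    totalDeg p = totalDeg q := by
  rw [totalDeg, totalDeg, h.1, h.degree_snd]

theorem prod_edgeMonomial_pow (u : Fin r →₀ ℕ) :
    (u.prod fun j n => (Polynomial.monomial 1 (edgeMonomial 𝕜 (e j : Sym2 V))) ^ n) =
      Polynomial.monomial u.degree (monomial (edgeDegree e u) (1 : 𝕜)) := by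
  classical
  induction u using Finsupp.induction_linear with
  | zero => simp
  | add f g hf hg =>
    rw [Finsupp.prod_add_index' (fun _ => pow_zero _) (fun _ _ _ => pow_add _ _ _), hf, hg,
      Polynomial.monomial_mul_monomial, monomial_mul, map_add, map_add, one_mul]
  | single j n =>
    rw [Finsupp.prod_single_index (h := fun j n =>
      (Polynomial.monomial 1 (edgeMonomial 𝕜 (e j : Sym2 V))) ^ n) (pow_zero _),
      Polynomial.monomial_pow, edgeMonomial, monomial_pow]
    simp

theorem coe_reesMap_monomial (u : Fin r →₀ ℕ) (a : V →₀ ℕ) (α : 𝕜) :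
    ((reesMap 𝕜 G e (monomial u (monomial a α)) : reesAlgebra (edgeIdeal 𝕜 G)) :
      Polynomial (MvPolynomial V 𝕜)) =
      Polynomial.monomial u.degree (monomial (a + edgeDegree e u) α) := by
  rw [← Subalgebra.coe_val, ← AlgHom.comp_apply, reesMap, comp_aeval, aeval_monomial]
  simp only [Subalgebra.coe_val]
  rw [prod_edgeMonomial_pow, Polynomial.algebraMap_eq, Polynomial.C_mul_monomial, monomial_mul,
    mul_one]

theorem mem_reesIdeal_iff {f : MvPolynomial (Fin r) (MvPolynomial V 𝕜)} :
    f ∈ reesIdeal 𝕜 G e ↔ ((reesMap 𝕜 G e f : reesAlgebra (edgeIdeal 𝕜 G)) :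
      Polynomial (MvPolynomial V 𝕜)) = 0 := by
  rw [reesIdeal, RingHom.mem_ker]
  exact ZeroMemClass.coe_eq_zero.symm

theorem SameImage.mem_reesIdeal {p q : (Fin r →₀ ℕ) × (V →₀ ℕ)} (h : SameImage e p q) :
    mono 𝕜 p - mono 𝕜 q ∈ reesIdeal 𝕜 G e := by
  rw [mem_reesIdeal_iff, map_sub, AddSubgroupClass.coe_sub, mono, mono, coe_reesMap_monomial,
    coe_reesMap_monomial, h.1, h.2, sub_self]

/-- The binomials in the Rees ideal are differences of monomials with equal image. -/
theorem IsBinomial.exists_of_mem_reesIdeal {f : MvPolynomial (Fin r) (MvPolynomial V 𝕜)}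
    (hf : IsBinomial f) (hJ : f ∈ reesIdeal 𝕜 G e) :
    ∃ (p q : (Fin r →₀ ℕ) × (V →₀ ℕ)) (α : 𝕜), p ≠ q ∧ α ≠ 0 ∧ SameImage e p q ∧
      f = C (C α) * (mono 𝕜 p - mono 𝕜 q) := by
  classical
  obtain ⟨u, u', a, a', α, α', hne, hα, hα', rfl⟩ := hf
  rw [mem_reesIdeal_iff, map_add, AddMemClass.coe_add, coe_reesMap_monomial,
    coe_reesMap_monomial] at hJ
  -- The image of the first monomial can only be cancelled by that of the second.
  have h1 := congrArg (fun g => coeff (a + edgeDegree e u) (g.coeff u.degree)) hJ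
  simp only [Polynomial.coeff_add, Polynomial.coeff_monomial, if_true, coeff_add,
    coeff_monomial, Polynomial.coeff_zero, coeff_zero] at h1
  by_cases hd : u'.degree = u.degree
  · by_cases hx : a' + edgeDegree e u' = a + edgeDegree e u
    · simp only [hd, hx, if_true, coeff_monomial] at h1
      refine ⟨(u, a), (u', a'), α, hne, hα, ⟨hd.symm, hx.symm⟩, ?_⟩
      obtain rfl : α' = -α := (neg_eq_of_add_eq_zero_right h1).symm
      rw [mono, mono, mul_sub, C_mul_monomial, C_mul_monomial, C_mul_monomial, C_mul_monomial,
        mul_one, map_neg, map_neg, sub_eq_add_neg]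
    · simp [hd, hx, coeff_monomial, hα] at h1
  · simp [hd, hα] at h1

/-- Substitution of `s x_v` for `x_v` and of `s T_j` for `T_j`; it detects homogeneity. -/
noncomputable def rescale (𝕜 V : Type*) [Field 𝕜] (r : ℕ) :
    MvPolynomial (Fin r) (MvPolynomial V 𝕜) →+*
      Polynomial (MvPolynomial (Fin r) (MvPolynomial V 𝕜)) :=
  eval₂Hom (eval₂Hom ((Polynomial.C.comp C).comp C) fun v => Polynomial.C (C (X v)) * Polynomial.X)
    fun j => Polynomial.C (X j) * Polynomial.X

theorem eval₂_monomial_mul_X {R σ A : Type*} [CommSemiring R] [CommSemiring A]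
    (f : R →+* Polynomial A) (g : σ → A) (u : σ →₀ ℕ) (c : R) :
    eval₂ f (fun i => Polynomial.C (g i) * Polynomial.X) (monomial u c) =
      f c * Polynomial.C (u.prod fun i n => g i ^ n) * Polynomial.X ^ u.degree := by
  rw [eval₂_monomial, Finsupp.prod, Finsupp.prod, map_prod, Finsupp.degree_apply,
    ← Finset.prod_pow_eq_pow_sum, mul_assoc, ← Finset.prod_mul_distrib]
  congr 1
  refine Finset.prod_congr rfl fun i _ => ?_
  rw [mul_pow, map_pow]

theorem rescale_mono (p : (Fin r →₀ ℕ) × (V →₀ ℕ)) :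
    rescale 𝕜 V r (mono 𝕜 p) = Polynomial.C (mono 𝕜 p) * Polynomial.X ^ totalDeg p := by
  have h : mono 𝕜 p = C (p.2.prod fun v n => X v ^ n) * (p.1.prod fun j n => X j ^ n) := by
    rw [mono, monomial_eq, monomial_eq (s := p.2), map_one, one_mul]
  rw [rescale, mono, coe_eval₂Hom, eval₂_monomial_mul_X, coe_eval₂Hom, eval₂_monomial_mul_X,
    ← mono, h]
  simp only [map_one, one_mul, totalDeg, map_mul, pow_add, map_finsuppProd, map_pow]
  ring

theorem rescale_C_C (α : 𝕜) : rescale 𝕜 V r (C (C α)) = Polynomial.C (C (C α)) := by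
  simp [rescale]

/-- A polynomial is homogeneous of degree `n` in all variables. -/
def IsHomog (f : MvPolynomial (Fin r) (MvPolynomial V 𝕜)) (n : ℕ) : Prop :=
  rescale 𝕜 V r f = Polynomial.C f * Polynomial.X ^ n

theorem SameImage.isHomog {p q : (Fin r →₀ ℕ) × (V →₀ ℕ)} (h : SameImage e p q) (α : 𝕜) :
    IsHomog (C (C α) * (mono 𝕜 p - mono 𝕜 q)) (totalDeg p) := by
  rw [IsHomog, map_mul, map_sub, rescale_mono, rescale_mono, rescale_C_C, ← h.totalDeg_eq]
  simp only [map_mul, map_sub]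
  ring

/-- Zero has to be excluded, since it satisfies `IsHomog` for every degree. -/
theorem IsHomog.degree_unique {f : MvPolynomial (Fin r) (MvPolynomial V 𝕜)} {m n : ℕ}
    (hm : IsHomog f m) (hn : IsHomog f n) (hf : f ≠ 0) : m = n := by
  by_contra hne
  have h := congrArg (fun g => Polynomial.coeff g m) (hm.symm.trans hn)
  simp [Polynomial.coeff_X_pow, hne] at h
  exact hf h

/-- A homogeneous element of an ideal with homogeneous generators is generated by the generators of
at most its degree. -/
theorem IsHomog.mem_span {S : Set (MvPolynomial (Fin r) (MvPolynomial V 𝕜))}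
    (hS : ∀ f ∈ S, ∃ n, IsHomog f n) {h : MvPolynomial (Fin r) (MvPolynomial V 𝕜)} {n : ℕ}
    (hh : IsHomog h n) (hmem : h ∈ Ideal.span S) :
    h ∈ Ideal.span {f ∈ S | ∃ m ≤ n, IsHomog f m} := by
  -- For induction over the span, the claim is extended to the components of arbitrary elements: the
  -- coefficient of `X ^ n` in the rescaling is the component of degree `n`.
  have key : ∀ h ∈ Ideal.span S, ∀ n,
      (rescale 𝕜 V r h).coeff n ∈ Ideal.span {f ∈ S | ∃ m ≤ n, IsHomog f m} := by
    intro h hmem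
    induction hmem using Submodule.span_induction with
    | mem x hx =>
      intro n
      obtain ⟨m, hm⟩ := hS x hx
      rw [hm, Polynomial.coeff_C_mul, Polynomial.coeff_X_pow]
      split_ifs with hnm
      · rw [mul_one]
        exact Ideal.subset_span ⟨hx, m, hnm.ge, hm⟩
      · simp
    | zero => simp
    | add x y _ _ hx hy =>
      intro n
      rw [map_add, Polynomial.coeff_add]
      exact add_mem (hx n) (hy n)
    | smul c x _ hx =>
      intro n
      rw [smul_eq_mul, map_mul, Polynomial.coeff_mul]
      refine sum_mem fun i hi => Ideal.mul_mem_left _ _ ?_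
      refine Ideal.span_mono ?_ (hx i.2)
      rintro f ⟨hf, m, hm, hfm⟩
      exact ⟨hf, m, hm.trans (by have := Finset.HasAntidiagonal.mem_antidiagonal.1 hi; omega), hfm⟩
  have := key h hmem n
  rwa [hh, Polynomial.coeff_C_mul, Polynomial.coeff_X_pow, if_pos rfl, mul_one] at this

/-- A binomial is generated in lower degree if one of its monomials can be exchanged, within a
proper factor, so that the monomials acquire a common factor. -/
theorem mono_sub_mono_mem_of_exchange {K : Ideal (MvPolynomial (Fin r) (MvPolynomial V 𝕜))}
    {p q : (Fin r →₀ ℕ) × (V →₀ ℕ)} (hpq : SameImage e p q)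
    (hK : ∀ p' q', SameImage e p' q' → totalDeg p' < totalDeg p → mono 𝕜 p' - mono 𝕜 q' ∈ K)
    {c d s s' l l' : (Fin r →₀ ℕ) × (V →₀ ℕ)} (hp : p = c + s) (hs : SameImage e s s')
    (hl : c + s' = d + l) (hq : q = d + l') (hc : 0 < totalDeg c) (hd : 0 < totalDeg d) :
    mono 𝕜 p - mono 𝕜 q ∈ K := by
  have h1 : SameImage e p (d + l) := by
    rw [hp, ← hl]; exact sameImage_add_left_iff.2 hs
  have h2 : SameImage e l l' := sameImage_add_left_iff.1 (hq ▸ h1.symm.trans hpq)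
  -- Pass through the intermediate monomial `c + s' = d + l`. Both differences have a nontrivial
  -- monomial factor, which leaves binomials of smaller degree.
  have h3 : mono 𝕜 p - mono 𝕜 q =
      mono 𝕜 c * (mono 𝕜 s - mono 𝕜 s') + mono 𝕜 d * (mono 𝕜 l - mono 𝕜 l') := by
    rw [mul_sub, mul_sub, ← mono_add, ← mono_add, ← mono_add, ← mono_add, hl, hp, hq]
    ring
  rw [h3]
  refine add_mem (Ideal.mul_mem_left _ _ (hK _ _ hs ?_)) (Ideal.mul_mem_left _ _ (hK _ _ h2 ?_))
  · rw [hp, totalDeg_add]; omega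
  · rw [h1.totalDeg_eq, totalDeg_add]; omega

end

end EdgeRees

/-! ### Nonlinear minimal generators come from even cycles -/

namespace EdgeRees

open MvPolynomial

section

variable {𝕜 : Type*} [Field 𝕜] {V : Type*} {r : ℕ} {G : SimpleGraph V} {e : Fin r ≃ G.edgeSet}

theorem exists_eq_single_add {σ : Type*} {u : σ →₀ ℕ} {j : σ} (h : u j ≠ 0) :
    ∃ u', u = Finsupp.single j 1 + u' :=
  le_iff_exists_add.1 (Finsupp.single_le_iff.2 (Nat.one_le_iff_ne_zero.2 h))

theorem edgeDegree_ne_zero {u : Fin r →₀ ℕ} {l : Fin r} {w y : V} (hl : u l ≠ 0)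
    (hy : (e l : Sym2 V) = s(w, y)) : edgeDegree e u w ≠ 0 := by
  obtain ⟨u', rfl⟩ := exists_eq_single_add hl
  simp [hy, edgeExp_mk]

theorem sameImage_zero_right {x y : Fin r →₀ ℕ} (h : edgeDegree e x = edgeDegree e y) :
    SameImage e (x, 0) (y, 0) := by
  refine ⟨?_, by simpa using h⟩
  have := congrArg Finsupp.degree h
  rw [degree_edgeDegree, degree_edgeDegree] at this
  simpa using this

/-- A binomial of degree at least two in the `T_j` that is not generated in lower degrees belongs
to an even cycle. -/
theorem exists_isEvenCycle_of_not_mem {K : Ideal (MvPolynomial (Fin r) (MvPolynomial V 𝕜))}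
    {p q : (Fin r →₀ ℕ) × (V →₀ ℕ)} (hpq : SameImage e p q)
    (hK : ∀ p' q', SameImage e p' q' → totalDeg p' < totalDeg p → mono 𝕜 p' - mono 𝕜 q' ∈ K)
    (hnot : mono 𝕜 p - mono 𝕜 q ∉ K) (hdeg : 2 ≤ p.1.degree) :
    ∃ (v : ℕ → V) (j : ℕ → Fin r) (n : ℕ), IsEvenCycle e v j n ∧
      (p = (evenExp j n, 0) ∧ q = (oddExp j n, 0) ∨
        p = (oddExp j n, 0) ∧ q = (evenExp j n, 0)) := by
  classical
  obtain ⟨u, a⟩ := p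
  obtain ⟨u', a'⟩ := q
  -- A common variable `x_v` can be factored out; no exchange is needed.
  have hcop : ∀ v, a v ≠ 0 → a' v = 0 := by
    intro v hv
    by_contra hv'
    obtain ⟨a, rfl⟩ := exists_eq_single_add hv
    obtain ⟨a', rfl⟩ := exists_eq_single_add hv'
    exact hnot (mono_sub_mono_mem_of_exchange hpq hK
      (c := (0, Finsupp.single v 1)) (s := (u, a)) (s' := (u, a)) (d := (0, Finsupp.single v 1))
      (l := (u, a)) (l' := (u', a')) (by simp) ⟨rfl, rfl⟩ rfl (by simp) (by simp [totalDeg])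
      (by simp [totalDeg]))
  have hsplit : ∀ l, u l ≠ 0 → ∃ w, u = Finsupp.single l 1 + w ∧ 0 < w.degree := by
    intro l hl
    obtain ⟨w, rfl⟩ := exists_eq_single_add hl
    refine ⟨w, rfl, ?_⟩
    simp at hdeg
    omega
  have hvertex : ∀ x, a x + edgeDegree e u x = a' x + edgeDegree e u' x :=
    fun x => DFunLike.congr_fun hpq.2 x
  have ha : a = 0 := by
    by_contra ha
    obtain ⟨v, hv⟩ := Finsupp.ne_iff.1 ha
    have hv : a v ≠ 0 := hv
    -- As `x_v` does not divide `x^a'`, the vertex `v` must lie on an edge `{v, w}` of `u'`. The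
    -- exchanges below bring its variable `T_j` into the first monomial.
    obtain ⟨j, w, hj, hjw⟩ := exists_edge_of_edgeDegree_ne_zero e (u := u') (w := v) (by
      have := hvertex v
      rw [hcop v hv] at this
      omega)
    have hw : edgeDegree e u' w ≠ 0 := edgeDegree_ne_zero hj (hjw.trans Sym2.eq_swap)
    obtain ⟨z, rfl⟩ := exists_eq_single_add hj
    by_cases hw' : edgeDegree e u w = 0
    -- No edge of `u` meets `w`, so `x_w` also divides `x^a`. Exchange `T_l x_v x_w` for `T_j f_l`,
    -- with any `l` in `u`.
    · have haw : a w ≠ 0 := by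
        have := hvertex w
        omega
      have hvw : v ≠ w := by
        have := (e j).2
        rw [hjw] at this
        exact G.ne_of_adj this
      obtain ⟨a, rfl⟩ := exists_eq_single_add hv
      have haw : a w ≠ 0 := by
        simpa [Finsupp.single_apply, hvw] using haw
      obtain ⟨a, rfl⟩ := exists_eq_single_add haw
      obtain ⟨l, hl⟩ := Finsupp.ne_iff.1 (show u ≠ 0 by rintro rfl; simp at hdeg)
      obtain ⟨y, rfl, hy⟩ := hsplit l hl
      refine hnot (mono_sub_mono_mem_of_exchange hpq hK
        (c := (y, a)) (s := (Finsupp.single l 1, Finsupp.single v 1 + Finsupp.single w 1))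
        (s' := (Finsupp.single j 1, edgeExp (e l : Sym2 V))) (d := (Finsupp.single j 1, 0))
        (l := (y, a + edgeExp (e l : Sym2 V))) (l' := (z, a')) ?_ ⟨?_, ?_⟩ ?_ ?_ ?_ ?_)
      · ext1
        · exact add_comm _ _
        · simp only [Prod.mk_add_mk]; abel
      · simp
      · simp [hjw, edgeExp_mk, add_comm]
      · ext1
        · exact add_comm _ _
        · simp
      · simp
      · simp [totalDeg, hy]
      · simp [totalDeg]
    -- With an edge `{w, x}` of `u`, exchange `T_l x_v` for `T_j x_x`. The rest `y` of `u` is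
    -- nontrivial because `u` has degree at least two.
    · obtain ⟨l, x, hl, hlx⟩ := exists_edge_of_edgeDegree_ne_zero e hw'
      obtain ⟨a, rfl⟩ := exists_eq_single_add hv
      obtain ⟨y, rfl, hy⟩ := hsplit l hl
      refine hnot (mono_sub_mono_mem_of_exchange hpq hK
        (c := (y, a)) (s := (Finsupp.single l 1, Finsupp.single v 1))
        (s' := (Finsupp.single j 1, Finsupp.single x 1)) (d := (Finsupp.single j 1, 0))
        (l := (y, a + Finsupp.single x 1)) (l' := (z, a')) ?_ ⟨?_, ?_⟩ ?_ ?_ ?_ ?_)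
      · ext1
        · exact add_comm _ _
        · exact add_comm _ _
      · simp
      · simp only [edgeDegree_single, hjw, hlx, edgeExp_mk, one_smul]
        abel
      · ext1
        · exact add_comm _ _
        · simp
      · simp
      · simp [totalDeg, hy]
      · simp [totalDeg]
  subst ha
  have ha' : a' = 0 := by
    have : (0 : V →₀ ℕ).degree = a'.degree := hpq.degree_snd
    rw [map_zero] at this
    exact (Finsupp.degree_eq_zero_iff _).1 this.symm
  subst ha'
  have huu' : edgeDegree e u = edgeDegree e u' := by simpa using hpq.2
  have hu0 : u ≠ 0 := by rintro rfl; simp at hdeg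
  -- If a proper part `x` of `u` balances a part `y` of `u'`, exchanging `T^x` for `T^y` creates the
  -- common factor `T^y`.
  have hmax : ∀ x y : Fin r →₀ ℕ, x ≤ u → y ≤ u' → edgeDegree e x = edgeDegree e y →
      0 < y.degree → u = x ∧ u' = y := by
    intro x y hx hy hxy hpos
    obtain ⟨c, rfl⟩ := le_iff_exists_add.1 hx
    obtain ⟨c', rfl⟩ := le_iff_exists_add.1 hy
    have hcc : c.degree = c'.degree := by
      have h1 := (sameImage_zero_right huu').1
      have h2 := (sameImage_zero_right hxy).1
      simp only [map_add] at h1 h2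
      omega
    rcases Nat.eq_zero_or_pos c.degree with hc | hc
    · rw [hc, eq_comm, Finsupp.degree_eq_zero_iff] at hcc
      rw [Finsupp.degree_eq_zero_iff] at hc
      simp [hc, hcc]
    · refine absurd (mono_sub_mono_mem_of_exchange hpq hK
        (c := (c, 0)) (s := (x, 0)) (s' := (y, 0)) (d := (y, 0)) (l := (c, 0)) (l' := (c', 0))
        ?_ (sameImage_zero_right hxy) ?_ ?_ ?_ ?_) hnot
      · simp [add_comm]
      · simp [add_comm]
      · simp
      · simpa [totalDeg] using hc
      · simpa [totalDeg] using hpos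
  obtain ⟨v, j, n, hcyc, hle⟩ := exists_isEvenCycle e huu' hu0
  have hdegs := (sameImage_zero_right hcyc.edgeDegree_eq).1
  have hsum := degree_evenExp_add_degree_oddExp j n
  have hn := hcyc.pos
  simp only at hdegs
  refine ⟨v, j, n, hcyc, ?_⟩
  rcases hle with ⟨h1, h2⟩ | ⟨h1, h2⟩
  · obtain ⟨rfl, rfl⟩ := hmax _ _ h1 h2 hcyc.edgeDegree_eq (by omega)
    exact Or.inl ⟨rfl, rfl⟩
  · obtain ⟨rfl, rfl⟩ := hmax _ _ h2 h1 hcyc.edgeDegree_eq.symm (by omega)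
    exact Or.inr ⟨rfl, rfl⟩

/-- The nonlinear members of a minimal system of binomial generators of the Rees ideal are the
binomials of even cycles. -/
theorem IsMinimalBinomialGenerators.exists_isEvenCycle
    {S : Set (MvPolynomial (Fin r) (MvPolynomial V 𝕜))}
    (hS : IsMinimalBinomialGenerators (reesIdeal 𝕜 G e) S)
    {f : MvPolynomial (Fin r) (MvPolynomial V 𝕜)} (hf : f ∈ S) (hlin : ¬ f.IsHomogeneous 1) :
    ∃ (v : ℕ → V) (j : ℕ → Fin r) (n : ℕ) (α : 𝕜), IsEvenCycle e v j n ∧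
      evenExp j n ≠ oddExp j n ∧ α ≠ 0 ∧
      f = C (C α) * map C (monomial (evenExp j n) 1 - monomial (oddExp j n) 1) := by
  obtain ⟨hbin, hspan, hirr⟩ := hS
  have hJ : ∀ g ∈ S, g ∈ reesIdeal 𝕜 G e := fun g hg => hspan ▸ Ideal.subset_span hg
  have hhomog : ∀ g ∈ S, ∃ n, IsHomog g n := by
    intro g hg
    obtain ⟨p, q, α, -, -, hpq, rfl⟩ := (hbin g hg).exists_of_mem_reesIdeal (hJ g hg)
    exact ⟨_, hpq.isHomog α⟩
  have hfK : f ∉ Ideal.span (S \ {f}) := by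
    intro hmem
    refine hirr f hf (le_antisymm ?_ ?_)
    · rw [← hspan]
      exact Ideal.span_mono Set.sdiff_subset
    · rw [← hspan, Ideal.span_le]
      intro g hg
      by_cases hgf : g = f
      · rw [hgf]; exact hmem
      · exact Ideal.subset_span ⟨hg, hgf⟩
  have hf0 : f ≠ 0 := fun h => hfK (h ▸ zero_mem _)
  obtain ⟨p, q, α, hne, hα, hpq, hfeq⟩ := (hbin f hf).exists_of_mem_reesIdeal (hJ f hf)
  have hfhom : IsHomog f (totalDeg p) := hfeq ▸ hpq.isHomog α
  -- Only generators of degree below that of `f` are needed here, and `f` is not among them.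
  have hK : ∀ p' q', SameImage e p' q' → totalDeg p' < totalDeg p →
      mono 𝕜 p' - mono 𝕜 q' ∈ Ideal.span (S \ {f}) := by
    intro p' q' h hlt
    have h1 : mono 𝕜 p' - mono 𝕜 q' ∈ Ideal.span S := hspan ▸ h.mem_reesIdeal
    have h2 : IsHomog (mono 𝕜 p' - mono 𝕜 q') (totalDeg p') := by
      simpa using h.isHomog (1 : 𝕜)
    refine Ideal.span_mono ?_ (h2.mem_span hhomog h1)
    rintro g ⟨hg, m, hm, hgm⟩
    refine ⟨hg, ?_⟩
    rintro rfl
    have := hgm.degree_unique hfhom hf0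
    omega
  have hnot : mono 𝕜 p - mono 𝕜 q ∉ Ideal.span (S \ {f}) := by
    intro h
    refine hfK ?_
    have := Ideal.mul_mem_left _ (C (C α)) h
    rwa [← hfeq] at this
  -- In degree zero in the `T_j` the two monomials would coincide; in degree one `f` would be
  -- linear.
  have hdeg : 2 ≤ p.1.degree := by
    by_contra hlt
    have hcases : p.1.degree = 0 ∨ p.1.degree = 1 := by omega
    rcases hcases with h | h
    · have hp : p.1 = 0 := (Finsupp.degree_eq_zero_iff _).1 h
      have hq : q.1 = 0 := (Finsupp.degree_eq_zero_iff _).1 (hpq.1 ▸ h)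
      refine hne (Prod.ext (hp.trans hq.symm) ?_)
      simpa [hp, hq] using hpq.2
    · refine hlin ?_
      have hp : (mono 𝕜 p).IsHomogeneous 1 := isHomogeneous_monomial _ h
      have hq : (mono 𝕜 q).IsHomogeneous 1 := isHomogeneous_monomial _ (hpq.1 ▸ h)
      have := (isHomogeneous_C (Fin r) (C α : MvPolynomial V 𝕜)).mul (hp.sub hq)
      rw [hfeq]
      simpa using this
  obtain ⟨v, j, n, hcyc, ⟨rfl, rfl⟩ | ⟨rfl, rfl⟩⟩ :=
    exists_isEvenCycle_of_not_mem hpq hK hnot hdeg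
  · refine ⟨v, j, n, α, hcyc, fun h => hne (by rw [h]), hα, ?_⟩
    rw [hfeq]
    simp [mono, map_monomial]
  · refine ⟨v, j, n, -α, hcyc, fun h => hne (by rw [h]), neg_ne_zero.2 hα, ?_⟩
    rw [hfeq]
    simp only [mono, map_sub, map_monomial, map_one, map_neg]
    rw [show (monomial 0 (1 : 𝕜) : MvPolynomial V 𝕜) = 1 from rfl]
    ring

end

end EdgeRees

/-! ### The main theorem -/

theorem mainTheorem4 {𝕜 : Type*} [Field 𝕜] {V : Type*} [Fintype V] (G : SimpleGraph V)
    {r : ℕ} (e : Fin r ≃ G.edgeSet)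
    (B : Matrix V (EdgeRees.Pairs r) (MvPolynomial (Fin r) (MvPolynomial V 𝕜)))
    (hB : EdgeRees.IsJacobianDual (EdgeRees.taylorMatrix 𝕜 G e) B)
    (k : ℕ) (hk : k = EdgeRees.genericRank (EdgeRees.reduce B)) :
    (∀ S : Set (MvPolynomial (Fin r) (MvPolynomial V 𝕜)),
      EdgeRees.IsMinimalBinomialGenerators (EdgeRees.reesIdeal 𝕜 G e) S →
      ∀ f ∈ S, ¬ f.IsHomogeneous 1 →
        ∃ g ∈ EdgeRees.minors (EdgeRees.reduce B) k, g ≠ 0 ∧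
          f ∣ MvPolynomial.map MvPolynomial.C g) ∧
    (∀ (v : V) (p : G.Walk v v), EdgeRees.IsPrimitiveEven p →
      EdgeRees.walkBinomial 𝕜 e p ≠ 0 →
        ∃ g ∈ EdgeRees.minors (EdgeRees.reduce B) k, g ≠ 0 ∧
          EdgeRees.walkBinomial 𝕜 e p ∣ g) := by
  subst hk
  refine ⟨fun S hS f hf hlin => ?_, fun v p hp hne => ?_⟩
  · obtain ⟨v, j, n, α, hcyc, hne, hα, rfl⟩ := hS.exists_isEvenCycle hf hlin
    obtain ⟨g, hg, hg0, hdvd⟩ := hcyc.exists_minor_dvd hne hB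
    refine ⟨g, hg, hg0, ?_⟩
    have hunit : IsUnit (MvPolynomial.C (MvPolynomial.C α) :
        MvPolynomial (Fin r) (MvPolynomial V 𝕜)) :=
      ((IsUnit.mk0 α hα).map MvPolynomial.C).map MvPolynomial.C
    rw [hunit.mul_left_dvd]
    exact map_dvd _ hdvd
  -- The walk of length zero has binomial `1 - 1 = 0`.
  · have hpos : 0 < p.length := by
      rw [Nat.pos_iff_ne_zero]
      intro h0
      apply hne
      have : IsEmpty (Fin p.length) := by rw [h0]; infer_instance
      simp [EdgeRees.walkBinomial]
    obtain ⟨j, hj⟩ := EdgeRees.exists_walkEdge_extension (e := e) p hpos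
    rw [EdgeRees.walkBinomial_eq hj] at hne ⊢
    exact (hp.isEvenCycle hj hpos).exists_minor_dvd (fun h => hne (by rw [h, sub_self])) hB
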